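/- Let $\mathcal H$ be a real Hilbert space. For a nonempty closed convex set $C\subseteq\mathcal H$ let $P_C\colon\mathcal H\to\mathcal H$ denote the projector onto $C$, which maps $x$ to the unique point of $C$ nearest to $x$. An operator $T\colon\mathcal H\to\mathcal H$ is called a projector if $T=P_C$ for some nonempty closed convex set $C\subseteq\mathcal H$, and monotone if $\langle x-y, Tx-Ty\rangle\ge 0$ for all $x,y\in\mathcal H$. The polar cone of $C$ is $C^{\ominus}=\{u\in\mathcal H : \langle x,u\rangle\le 0 \text{ for all } x\in C\}$. Let $K_1$ and $K_2$ be nonempty closed convex cones in $\mathcal H$. Then the following are equivalent: 1. $P_{K_1\cap K_2}=P_{K_1}+P_{K_2}-\mathrm{Id}$; 2. $P_{K_1}+P_{K_2}-\mathrm{Id}$ is a projector; 3. $P_{K_1}+P_{K_2}-\mathrm{Id}$ is monotone; 4. $\|P_{K_1}x\|^2+\|P_{K_2}x\|^2=\|x\|^2+\langle P_{K_1}x,P_{K_2}x\rangle$ for every $x\in\mathcal H$. Moreover (Zarantonello), $P_{K_2}P_{K_1}=P_{K_2}$ if and only if $P_{K_1}-P_{K_2}$ is a projector, in which case $P_{K_1}-P_{K_2}=P_{K_1\cap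 K_2^{\ominus}}$. -/

import Mathlib

namespace HilbertProj

variable {H : Type*} [NormedAddCommGroup H] [InnerProductSpace ℝ H]

set_option linter.unusedSectionVars false

/-- `p` is a best approximation to `x` from the set `C`, i.e. a nearest point of `C` to `x`. -/
def IsNearest (C : Set H) (x p : H) : Prop :=
  p ∈ C ∧ ∀ y ∈ C, ‖x - p‖ ≤ ‖x - y‖

/-- The projector `P_C`: it sends `x` to its nearest point in `C`.  In a Hilbert space, if `C` is
nonempty, closed and convex, this point exists and is unique (`isNearest_iff` below).
The value is unspecified at points without a nearest point in `C`. -/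
noncomputable def projector (C : Set H) (x : H) : H :=
  Classical.epsilon (IsNearest C x)

/-- The nearest point is characterised by the usual equality with the infimum. -/
theorem isNearest_iff_iInf {C : Set H} (hne : C.Nonempty) (x p : H) :
    IsNearest C x p ↔ p ∈ C ∧ ‖x - p‖ = ⨅ w : C, ‖x - w‖ := by
  have : Nonempty C := hne.to_subtype
  have hb : BddBelow (Set.range fun w : C => ‖x - w‖) :=
    ⟨0, Set.forall_mem_range.2 fun _ => norm_nonneg _⟩
  constructor
  · rintro ⟨hp, h⟩
    exact ⟨hp, le_antisymm (le_ciInf fun w => h w w.2) (ciInf_le hb ⟨p, hp⟩)⟩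
  · rintro ⟨hp, h⟩
    exact ⟨hp, fun y hy => h ▸ ciInf_le hb ⟨y, hy⟩⟩

/-- On a nonempty closed convex subset of a Hilbert space the projector is the nearest point map:
`projector C x` is the one and only nearest point of `C` to `x`. -/
theorem isNearest_iff [CompleteSpace H] {C : Set H} (hne : C.Nonempty) (hcl : IsClosed C)
    (hcv : Convex ℝ C) (x p : H) : IsNearest C x p ↔ p = projector C x := by
  have hex : ∃ q, IsNearest C x q := by
    obtain ⟨v, hv, h⟩ := exists_norm_eq_iInf_of_complete_convex hne hcl.isComplete hcv x
    exact ⟨v, (isNearest_iff_iInf hne x v).2 ⟨hv, h⟩⟩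
  have hs : IsNearest C x (projector C x) := Classical.epsilon_spec hex
  constructor
  · intro hp
    have h1 := (isNearest_iff_iInf hne x p).1 hp
    have h2 := (isNearest_iff_iInf hne x _).1 hs
    have a := (norm_eq_iInf_iff_real_inner_le_zero hcv h1.1).1 h1.2 _ h2.1
    have b := (norm_eq_iInf_iff_real_inner_le_zero hcv h2.1).1 h2.2 _ h1.1
    have c : inner ℝ (p - projector C x) (p - projector C x) ≤ 0 := by
      have e : p - projector C x = (x - projector C x) - (x - p) := by abel
      have e2 : projector C x - p = -(p - projector C x) := by abel
      rw [e2, inner_neg_right] at a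
      calc inner ℝ (p - projector C x) (p - projector C x)
          = inner ℝ ((x - projector C x) - (x - p)) (p - projector C x) := by rw [← e]
        _ = inner ℝ (x - projector C x) (p - projector C x)
            - inner ℝ (x - p) (p - projector C x) := inner_sub_left _ _ _
        _ ≤ 0 := by linarith
    rw [real_inner_self_eq_norm_sq] at c
    exact sub_eq_zero.1 (norm_eq_zero.1 (pow_eq_zero_iff two_ne_zero |>.1
      (le_antisymm c (sq_nonneg _))))
  · rintro rfl
    exact hs

/-- `T` belongs to `Proj(H)`: it is the projector onto some nonempty closed convex set. -/
def IsProjector (T : H → H) : Prop :=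
  ∃ C : Set H, C.Nonempty ∧ IsClosed C ∧ Convex ℝ C ∧ T = projector C

/-- Monotone operators (in the sense of Hilbert space operator theory). -/
def IsMonotone (T : H → H) : Prop :=
  ∀ x y : H, 0 ≤ inner ℝ (x - y) (T x - T y)

/-- A cone: a set stable under multiplication by strictly positive reals. -/
def IsCone (K : Set H) : Prop :=
  ∀ c : ℝ, 0 < c → ∀ x ∈ K, c • x ∈ K

/-- The polar cone `{u | sup_{x ∈ C} ⟪x, u⟫ ≤ 0}`. -/
def polarCone (C : Set H) : Set H :=
  {u | ∀ x ∈ C, inner ℝ x u ≤ 0}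

end HilbertProj

namespace HilbertProj

open Set

variable {H : Type*} [NormedAddCommGroup H] [InnerProductSpace ℝ H]

/-! Everything reduces to `tfae_projector_sub`: for closed convex cones K and L, P_K - P_L is a
projector iff x - P_K x is orthogonal to P_L x for every x. This gives Zarantonello's result
directly. Taking for L the polar of K₂, Moreau's decomposition turns P_K₁ - P_L into P_K₁ + P_K₂ -
Id, the bipolar theorem turns K₁ ∩ L^⊖ into K₁ ∩ K₂, and orthogonality becomes the norm identity.
The substance is that orthogonality forces P_L P_K = P_L, via rays on which P_K is constant, and
that orthogonality is invariant under (K, L) ↦ (L^⊖, K^⊖). -/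

/-- Nonempty closed convex cones. -/
structure IsClosedConvexCone (K : Set H) : Prop where
  nonempty : K.Nonempty
  isClosed : IsClosed K
  convex : Convex ℝ K
  isCone : IsCone K

/-! ### Firm nonexpansiveness -/

section GeneralProjector

variable [CompleteSpace H] {C : Set H}

theorem eq_projector_iff (hne : C.Nonempty) (hcl : IsClosed C) (hcv : Convex ℝ C) {x p : H} :
    p = projector C x ↔ p ∈ C ∧ ∀ w ∈ C, inner ℝ (x - p) (w - p) ≤ 0 := by
  rw [← isNearest_iff hne hcl hcv, isNearest_iff_iInf hne]
  exact and_congr_right fun hp => norm_eq_iInf_iff_real_inner_le_zero hcv hp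

/-- Projectors are firmly nonexpansive. -/
theorem norm_projector_sub_sq_le (hne : C.Nonempty) (hcl : IsClosed C) (hcv : Convex ℝ C)
    (x y : H) :
    ‖projector C x - projector C y‖ ^ 2 ≤ inner ℝ (x - y) (projector C x - projector C y) := by
  obtain ⟨hx, hx'⟩ := (eq_projector_iff hne hcl hcv (x := x)).1 rfl
  obtain ⟨hy, hy'⟩ := (eq_projector_iff hne hcl hcv (x := y)).1 rfl
  have h₁ := hx' _ hy
  have h₂ := hy' _ hx
  rw [← real_inner_self_eq_norm_sq]
  simp only [inner_sub_left, inner_sub_right] at *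
  linarith

theorem norm_projector_sub_le (hne : C.Nonempty) (hcl : IsClosed C) (hcv : Convex ℝ C)
    (x y : H) : ‖projector C x - projector C y‖ ≤ ‖x - y‖ := by
  have h := norm_projector_sub_sq_le hne hcl hcv x y
  have h' := real_inner_le_norm (x - y) (projector C x - projector C y)
  nlinarith [norm_nonneg (projector C x - projector C y), norm_nonneg (x - y)]

theorem IsProjector.isMonotone {T : H → H} (hT : IsProjector T) : IsMonotone T := by
  obtain ⟨C, hne, hcl, hcv, rfl⟩ := hT
  exact fun x y => (sq_nonneg _).trans (norm_projector_sub_sq_le hne hcl hcv x y)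

end GeneralProjector

namespace IsClosedConvexCone

variable {K L : Set H}

theorem zero_mem (hK : IsClosedConvexCone K) : (0 : H) ∈ K := by
  obtain ⟨k, hk⟩ := hK.nonempty
  -- Cones are only stable under strictly positive scalars, so 0 is reached as a limit and
  -- closedness is needed.
  have hlim : Filter.Tendsto (fun t : ℝ => t • k) (nhdsWithin 0 (Ioi 0)) (nhds 0) := by
    have hc : Continuous fun t : ℝ => t • k := by fun_prop
    simpa using (hc.tendsto 0).mono_left nhdsWithin_le_nhds
  exact hK.isClosed.mem_of_tendsto hlim
    (Filter.eventually_of_mem self_mem_nhdsWithin fun t ht => hK.isCone t ht k hk)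

theorem add_mem (hK : IsClosedConvexCone K) {x y : H} (hx : x ∈ K) (hy : y ∈ K) :
    x + y ∈ K := by
  have h := hK.isCone 2 two_pos _
    (hK.convex hx hy (by norm_num : (0 : ℝ) ≤ 1 / 2) (by norm_num : (0 : ℝ) ≤ 1 / 2) (by norm_num))
  simpa [smul_smul] using h

theorem inter (hK : IsClosedConvexCone K) (hL : IsClosedConvexCone L) :
    IsClosedConvexCone (K ∩ L) where
  nonempty := ⟨0, hK.zero_mem, hL.zero_mem⟩
  isClosed := hK.isClosed.inter hL.isClosed
  convex := hK.convex.inter hL.convex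
  isCone c hc x hx := ⟨hK.isCone c hc x hx.1, hL.isCone c hc x hx.2⟩

end IsClosedConvexCone

theorem isClosedConvexCone_polarCone (C : Set H) : IsClosedConvexCone (polarCone C) where
  nonempty := ⟨0, fun x _ => by simp⟩
  isClosed := by
    simp only [polarCone, ofPred_forall]
    exact isClosed_biInter fun x _ => isClosed_le (by fun_prop) continuous_const
  convex u hu v hv a b ha hb _ x hx := by
    rw [inner_add_right, real_inner_smul_right, real_inner_smul_right]
    nlinarith [mul_nonneg ha (neg_nonneg.2 (hu x hx)), mul_nonneg hb (neg_nonneg.2 (hv x hx))]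
  isCone c hc u hu x hx := by
    rw [real_inner_smul_right]
    exact mul_nonpos_of_nonneg_of_nonpos hc.le (hu x hx)

/-! ### Conical projections and their differences -/

namespace IsClosedConvexCone

variable [CompleteSpace H] {K L : Set H}

/-- Characterization of the projection onto a closed convex cone. -/
theorem eq_projector_iff (hK : IsClosedConvexCone K) {x p : H} :
    p = projector K x ↔ p ∈ K ∧ inner ℝ p (x - p) = 0 ∧ x - p ∈ polarCone K := by
  rw [HilbertProj.eq_projector_iff hK.nonempty hK.isClosed hK.convex]
  refine and_congr_right fun hp => ⟨fun h => ?_, fun ⟨h₀, h⟩ w hw => ?_⟩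
  · have h₁ := h 0 hK.zero_mem
    have h₂ := h (p + p) (hK.add_mem hp hp)
    rw [zero_sub, inner_neg_right] at h₁
    rw [add_sub_cancel_right] at h₂
    refine ⟨by rw [real_inner_comm]; linarith, fun k hk => ?_⟩
    simpa [real_inner_comm] using h (k + p) (hK.add_mem hk hp)
  · have := h w hw
    rw [real_inner_comm, inner_sub_left]
    linarith

theorem projector_mem (hK : IsClosedConvexCone K) (x : H) : projector K x ∈ K :=
  (hK.eq_projector_iff.1 rfl).1

theorem inner_projector_sub_projector (hK : IsClosedConvexCone K) (x : H) :
    inner ℝ (projector K x) (x - projector K x) = 0 :=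
  (hK.eq_projector_iff.1 rfl).2.1

theorem sub_projector_mem_polarCone (hK : IsClosedConvexCone K) (x : H) :
    x - projector K x ∈ polarCone K :=
  (hK.eq_projector_iff.1 rfl).2.2

theorem projector_sub_sq_le (hK : IsClosedConvexCone K) (x y : H) :
    ‖projector K x - projector K y‖ ^ 2 ≤ inner ℝ (x - y) (projector K x - projector K y) :=
  norm_projector_sub_sq_le hK.nonempty hK.isClosed hK.convex x y

/-- Moreau decomposition. -/
theorem projector_polarCone (hK : IsClosedConvexCone K) (x : H) :
    projector (polarCone K) x = x - projector K x := by
  symm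
  rw [(isClosedConvexCone_polarCone K).eq_projector_iff, sub_sub_cancel, real_inner_comm]
  refine ⟨hK.sub_projector_mem_polarCone x, hK.inner_projector_sub_projector x, fun u hu => ?_⟩
  rw [real_inner_comm]
  exact hu _ (hK.projector_mem x)

/-- The bipolar theorem. -/
theorem polarCone_polarCone (hK : IsClosedConvexCone K) : polarCone (polarCone K) = K := by
  refine Subset.antisymm (fun x hx => ?_) fun x hx u hu => real_inner_comm u x ▸ hu x hx
  have h₁ : x = projector (polarCone (polarCone K)) x :=
    (isClosedConvexCone_polarCone _).eq_projector_iff.2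
      ⟨hx, by simp, by simpa using (isClosedConvexCone_polarCone _).zero_mem⟩
  rw [(isClosedConvexCone_polarCone K).projector_polarCone, hK.projector_polarCone,
    sub_sub_cancel] at h₁
  exact h₁ ▸ hK.projector_mem x

/-- Moving along the ray from `P_K x` through `x` does not change the projection. -/
theorem projector_add_smul (hK : IsClosedConvexCone K) (x : H) {s : ℝ} (hs : 0 < s) :
    projector K (projector K x + s • (x - projector K x)) = projector K x := by
  symm
  rw [hK.eq_projector_iff, add_sub_cancel_left, real_inner_smul_right,
    hK.inner_projector_sub_projector, mul_zero]
  exact ⟨hK.projector_mem x, rfl,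
    (isClosedConvexCone_polarCone K).isCone s hs _ (hK.sub_projector_mem_polarCone x)⟩

theorem projector_projector_self (hK : IsClosedConvexCone K) (x : H) :
    projector K (projector K x) = projector K x := by
  symm
  rw [hK.eq_projector_iff, sub_self, inner_zero_right]
  exact ⟨hK.projector_mem x, rfl, (isClosedConvexCone_polarCone K).zero_mem⟩

/-- `P_L P_K = P_L` exactly when the residual of `P_K` is pointwise orthogonal to `P_L`. -/
theorem forall_projector_projector_iff (hK : IsClosedConvexCone K) (hL : IsClosedConvexCone L) :
    (∀ x, projector L (projector K x) = projector L x) ↔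
      ∀ x, inner ℝ (x - projector K x) (projector L x) = 0 := by
  refine ⟨fun h x => ?_, fun h x => ?_⟩
  · have h₁ := hL.inner_projector_sub_projector x
    have h₂ := hL.inner_projector_sub_projector (projector K x)
    rw [h x] at h₂
    rw [real_inner_comm]
    simp only [inner_sub_right] at *
    linarith
  · set q := x - projector K x with hq
    -- On the open ray P_K is constant, so q is orthogonal to every value of P_L there; firm
    -- nonexpansiveness then makes P_L constant along it.
    have key : ∀ s : ℝ, 0 < s → projector L (projector K x + s • q) = projector L x := by
      intro s hs
      have h₁ := h (projector K x + s • q)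
      rw [hK.projector_add_smul x hs, add_sub_cancel_left, real_inner_smul_left] at h₁
      have h₂ := (mul_eq_zero.1 h₁).resolve_left hs.ne'
      have h₃ := hL.projector_sub_sq_le (projector K x + s • q) x
      have e : projector K x + s • q - x = (s - 1) • q := by rw [hq]; module
      rw [e, real_inner_smul_left, inner_sub_right, h₂, h x, sub_zero, mul_zero] at h₃
      exact sub_eq_zero.1 (norm_eq_zero.1 (pow_eq_zero_iff two_ne_zero |>.1
        (le_antisymm h₃ (sq_nonneg _))))
    -- Letting s → 0 carries this constancy to the endpoint P_K x.
    have hbound : ∀ s : ℝ, 0 < s → ‖projector L (projector K x) - projector L x‖ ≤ s * ‖q‖ := by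
      intro s hs
      have := norm_projector_sub_le hL.nonempty hL.isClosed hL.convex (projector K x)
        (projector K x + s • q)
      rwa [key s hs, sub_add_cancel_left, norm_neg, norm_smul, Real.norm_of_nonneg hs.le] at this
    refine sub_eq_zero.1 (norm_le_zero_iff.1 (le_of_forall_pos_le_add fun ε hε => ?_))
    have hq1 : 0 < ‖q‖ + 1 := by positivity
    have h₁ := hbound (ε / (‖q‖ + 1)) (by positivity)
    have h₂ : ε / (‖q‖ + 1) * ‖q‖ ≤ ε := by
      rw [div_mul_eq_mul_div, div_le_iff₀ hq1]
      nlinarith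
    linarith

/-- At the pair x, P_K x the increment of P_K vanishes, so monotonicity bounds the pairing for P_L
above by 0, while firm nonexpansiveness bounds it below by a squared norm. -/
theorem projector_projector_of_isMonotone_sub (hK : IsClosedConvexCone K)
    (hL : IsClosedConvexCone L) (h : IsMonotone (projector K - projector L)) (x : H) :
    projector L (projector K x) = projector L x := by
  have h₁ := h x (projector K x)
  have h₂ := hL.projector_sub_sq_le x (projector K x)
  simp only [Pi.sub_apply, hK.projector_projector_self] at h₁
  rw [sub_sub_sub_cancel_left, ← neg_sub (projector L x), inner_neg_right] at h₁
  have h₃ : ‖projector L x - projector L (projector K x)‖ ^ 2 = 0 :=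
    le_antisymm (by linarith) (sq_nonneg _)
  exact (sub_eq_zero.1 (norm_eq_zero.1 (pow_eq_zero_iff two_ne_zero |>.1 h₃))).symm

theorem projector_sub_eq_of_inner_eq_zero (hK : IsClosedConvexCone K) (hL : IsClosedConvexCone L)
    (h : ∀ x, inner ℝ (x - projector K x) (projector L x) = 0) :
    projector K - projector L = projector (K ∩ polarCone L) := by
  have hK' := isClosedConvexCone_polarCone K
  have hL' := isClosedConvexCone_polarCone L
  have h₁ := (hK.forall_projector_projector_iff hL).2 h
  -- The dual pair gives P_K (x - P_L x) = P_K x - P_L x, hence membership in K; `h₁` gives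
  -- membership in the polar of L.
  have h₂ := (hL'.forall_projector_projector_iff hK').2 fun x => by
    rw [hL.projector_polarCone, hK.projector_polarCone, sub_sub_cancel, real_inner_comm]
    exact h x
  funext x
  rw [(hK.inter hL').eq_projector_iff, Pi.sub_apply]
  refine ⟨⟨?_, ?_⟩, ?_, fun k hk => ?_⟩
  · have h₃ := h₂ x
    rw [hL.projector_polarCone, hK.projector_polarCone, hK.projector_polarCone] at h₃
    have e : projector K x - projector L x = projector K (x - projector L x) := by
      rw [← sub_sub_cancel (x - projector L x) (projector K (x - projector L x)), h₃]
      abel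
    exact e ▸ hK.projector_mem _
  · have := hL.sub_projector_mem_polarCone (projector K x)
    rwa [h₁ x] at this
  · have h₃ := h x
    have h₄ := hK.inner_projector_sub_projector x
    have h₅ := hL.inner_projector_sub_projector x
    simp only [inner_sub_left, inner_sub_right, real_inner_comm] at *
    simp only [real_inner_comm (projector L x), real_inner_comm (projector K x) x] at *
    linarith
  · have h₃ := hK.sub_projector_mem_polarCone x k hk.1
    have h₄ := hk.2 _ (hL.projector_mem x)
    rw [real_inner_comm] at h₄
    rw [← sub_add, inner_add_right]
    linarith

/-- Equivalent conditions for a difference of projectors onto cones to be a projector. -/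
theorem tfae_projector_sub (hK : IsClosedConvexCone K) (hL : IsClosedConvexCone L) :
    List.TFAE
      [projector K - projector L = projector (K ∩ polarCone L),
        IsProjector (projector K - projector L),
        IsMonotone (projector K - projector L),
        ∀ x, projector L (projector K x) = projector L x,
        ∀ x, inner ℝ (x - projector K x) (projector L x) = 0] := by
  tfae_have 1 → 2 := fun h =>
    have hKL := hK.inter (isClosedConvexCone_polarCone L)
    ⟨_, hKL.nonempty, hKL.isClosed, hKL.convex, h⟩
  tfae_have 2 → 3 := IsProjector.isMonotone
  tfae_have 3 → 4 := hK.projector_projector_of_isMonotone_sub hL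
  tfae_have 4 ↔ 5 := hK.forall_projector_projector_iff hL
  tfae_have 5 → 1 := hK.projector_sub_eq_of_inner_eq_zero hL
  tfae_finish

/-- Expand, using ⟨P x, x⟩ = ‖P x‖² for both projectors. -/
theorem inner_sub_projector_sub_projector_eq_zero_iff (hK : IsClosedConvexCone K)
    (hL : IsClosedConvexCone L) (x : H) :
    inner ℝ (x - projector K x) (x - projector L x) = 0 ↔
      ‖projector K x‖ ^ 2 + ‖projector L x‖ ^ 2 =
        ‖x‖ ^ 2 + inner ℝ (projector K x) (projector L x) := by
  have h₁ := hK.inner_projector_sub_projector x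
  have h₂ := hL.inner_projector_sub_projector x
  simp only [inner_sub_left, inner_sub_right, real_inner_self_eq_norm_sq,
    real_inner_comm (projector L x) x] at *
  constructor <;> intro h <;> linarith

end IsClosedConvexCone

end HilbertProj

theorem corollaryc {H : Type*} [NormedAddCommGroup H] [InnerProductSpace ℝ H] [CompleteSpace H]
    (K₁ K₂ : Set H)
    (hne₁ : K₁.Nonempty) (hcl₁ : IsClosed K₁) (hcv₁ : Convex ℝ K₁)
    (hcone₁ : HilbertProj.IsCone K₁)
    (hne₂ : K₂.Nonempty) (hcl₂ : IsClosed K₂) (hcv₂ : Convex ℝ K₂)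
    (hcone₂ : HilbertProj.IsCone K₂) :
    List.TFAE
      [HilbertProj.projector (K₁ ∩ K₂) =
          HilbertProj.projector K₁ + HilbertProj.projector K₂ - id,
        HilbertProj.IsProjector (HilbertProj.projector K₁ + HilbertProj.projector K₂ - id),
        HilbertProj.IsMonotone (HilbertProj.projector K₁ + HilbertProj.projector K₂ - id),
        ∀ x : H, ‖HilbertProj.projector K₁ x‖ ^ 2 + ‖HilbertProj.projector K₂ x‖ ^ 2 =
          ‖x‖ ^ 2 + inner ℝ (HilbertProj.projector K₁ x) (HilbertProj.projector K₂ x)] ∧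
    (HilbertProj.projector K₂ ∘ HilbertProj.projector K₁ = HilbertProj.projector K₂ ↔
      HilbertProj.IsProjector (HilbertProj.projector K₁ - HilbertProj.projector K₂)) ∧
    (HilbertProj.IsProjector (HilbertProj.projector K₁ - HilbertProj.projector K₂) →
      HilbertProj.projector K₁ - HilbertProj.projector K₂ =
        HilbertProj.projector (K₁ ∩ HilbertProj.polarCone K₂)) := by
  have h₁ : HilbertProj.IsClosedConvexCone K₁ := ⟨hne₁, hcl₁, hcv₁, hcone₁⟩
  have h₂ : HilbertProj.IsClosedConvexCone K₂ := ⟨hne₂, hcl₂, hcv₂, hcone₂⟩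
  have hsub := h₁.tfae_projector_sub h₂
  refine ⟨?_, Iff.trans ?_ (hsub.out 3 1), (hsub.out 1 0).1⟩
  · have h := h₁.tfae_projector_sub (HilbertProj.isClosedConvexCone_polarCone K₂)
    have e : HilbertProj.projector K₁ - HilbertProj.projector (HilbertProj.polarCone K₂) =
        HilbertProj.projector K₁ + HilbertProj.projector K₂ - id := by
      funext x
      simp only [Pi.sub_apply, Pi.add_apply, id, h₂.projector_polarCone]
      abel
    simp only [e, h₂.polarCone_polarCone, h₂.projector_polarCone,
      h₁.inner_sub_projector_sub_projector_eq_zero_iff h₂] at h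
    tfae_have 1 ↔ 2 := eq_comm.trans (h.out 0 1)
    tfae_have 2 ↔ 3 := h.out 1 2
    tfae_have 3 ↔ 4 := h.out 2 4
    tfae_finish
  · exact funext_iff
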